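/- Let $A$ be a partial combinatory algebra (pca): a set with a partial application $(a,b)\mapsto ab$ and elements $\mathsf k,\mathsf s\in A$ such that for all $a,b,c$: $\mathsf sab$ is defined, $\mathsf kab=a$, and if $ac(bc)$ is defined then $\mathsf sabc$ is defined and equal to it. Use the usual booleans $\mathsf T=\mathsf k$, $\mathsf F=\mathsf k(\mathsf s\mathsf k\mathsf k)$, the usual pairing $\mathsf pab=\langle z\rangle zab$, and the coding of finite sequences $[\,]=\mathsf p\mathsf T(\mathsf s\mathsf k\mathsf k)$, $[u_0,\dots,u_n]=\mathsf p\mathsf F(\mathsf p u_0[u_1,\dots,u_n])$. For a partial function $f:A\to A$ write $a\cdot^f b=c$ if there are $n\ge 0$ and $u_0,\dots,u_{n-1}\in A$ such that for each $i<n$ there is $v_i$ with $a[b,u_0,\dots,u_{i-1}]=\mathsf p\mathsf Fv_i$ and $f(v_i)=u_i$, and $a[b,u_0,\dots,u_{n-1}]=\mathsf p\mathsf Tc$; this is the application of $A[f]$. Let $F:A^A\to A$ be a total functional. Put $f_0=\emptyset$; $f_{\alpha+1}(a)=b$ iff there is a total $g:A\to A$ with $a\cdot^{f_\alpha}w=g(w)$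 for all $w$ and $F(g)=b$; $f_\lambda=\bigcup_{\alpha<\lambda}f_\alpha$ for limit $\lambda$. Let $f=\bigcup_\alpha f_\alpha$ and let $A[F]=A[f]$, with application $\cdot^F$. For $P,Q\subseteq A$ let $P\to Q$ be the set of $a\in A$ such that $ab$ is defined and in $Q$ for all $b\in P$. A *local operator* is a map $J:\mathcal P(A)\to\mathcal P(A)$ for which each of $\bigcap_P(P\to JP)$, $\bigcap_P(JJP\to JP)$ and $\bigcap_{P,Q}\big((P\to Q)\to(JP\to JQ)\big)$ is nonempty; $J\le J'$ means that $\bigcap_P(JP\to J'P)$ is nonempty. A *$J$-assembly* is a set $X$ with a map $E$ from $X$ to nonempty subsets of $A$; a morphism $(X,E)\to(Y,G)$ is a function $h:X\to Y$ tracked by some $t\in A$, i.e. $t\in\bigcap_x(E(x)\to J\,G(h(x)))$. Let $\mathbf A=(A,a\mapsto\{a\})$, and let $\mathbf A^{\mathbf A}$ be the $J$-assembly of morphisms $\mathbf A\to\mathbf A$, each realized by the elements tracking it. Say that $F$ defines a morphism of $J$-assemblies $\mathbf A^{\mathbf A}\to\mathbf A$ if its restriction to the morphisms $\mathbf A\to\mathbf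 A$ is one. Theorem. There exists $m\in A$ witnessing that the identity $A\to A[F]$ is computationally dense, that is, such that for every $b\in A$ there is $a\in A$ such that for all $a'\in A$ with $b\cdot^Fa'$ defined, $aa'$ and $m\cdot^F(aa')$ are defined and $m\cdot^F(aa')=b\cdot^Fa'$. For every such $m$ the map $$J_F(P)=\{a\in A\mid m\cdot^Fa\text{ is defined and } m\cdot^Fa\in P\}$$ is a local operator, $F$ defines a morphism $\mathbf A^{\mathbf A}\to\mathbf A$ of $J_F$-assemblies, and $J_F\le J$ for every local operator $J$ such that $F$ defines a morphism $\mathbf A^{\mathbf A}\to\mathbf A$ of $J$-assemblies. So $J_F$ is the least local operator with this property. -/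

import Mathlib

universe u

namespace Realizability

/-- A partial applicative structure: a partial binary operation `(a, b) ↦ ab`. -/
class PartialApplicative (A : Type u) where
  app : A → A → Part A

/-- Application of closed terms: `t s` denotes `c` iff `t` denotes some `a`, `s` denotes some `b`
and `ab = c`. -/
def papp {A : Type u} [PartialApplicative A] (t s : Part A) : Part A :=
  t.bind fun a => s.bind fun b => PartialApplicative.app a b

infixl:75 " ⬝ₚ " => papp

/-- A partial combinatory algebra (not necessarily strict): `s a b ↓`, `k a b = a`, and
if `a c (b c)` is defined then `s a b c` is defined with the same value. -/
class PCA (A : Type u) extends PartialApplicative A where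
  k : A
  s : A
  s_dom : ∀ a b : A, (Part.some s ⬝ₚ Part.some a ⬝ₚ Part.some b).Dom
  k_eq : ∀ a b : A, Part.some k ⬝ₚ Part.some a ⬝ₚ Part.some b = Part.some a
  s_app : ∀ a b c d : A,
    d ∈ (Part.some a ⬝ₚ Part.some c) ⬝ₚ (Part.some b ⬝ₚ Part.some c) →
    d ∈ Part.some s ⬝ₚ Part.some a ⬝ₚ Part.some b ⬝ₚ Part.some c

section Coding

variable {A : Type u} [PCA A]

theorem k_dom (a : A) : (Part.some PCA.k ⬝ₚ Part.some a).Dom := by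
  have h : (Part.some PCA.k ⬝ₚ Part.some a ⬝ₚ Part.some a).Dom := by
    rw [PCA.k_eq a a]; trivial
  exact h.fst

/-- The element `k a`. -/
def kc (a : A) : A := (Part.some PCA.k ⬝ₚ Part.some a).get (k_dom a)

/-- The element `s a b`. -/
def sc (a b : A) : A := (Part.some PCA.s ⬝ₚ Part.some a ⬝ₚ Part.some b).get (PCA.s_dom a b)

variable (A) in
/-- The identity combinator `i = s k k`. -/
def ic : A := sc PCA.k PCA.k

variable (A) in
/-- The boolean `T = k`, so that `T a b = a`. -/
def tt : A := PCA.k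

variable (A) in
/-- The boolean `F = k i`, so that `F a b = b`. -/
def ff : A := kc (ic A)

/-- The pair `p a b = ⟨z⟩ z a b`, written with `k` and `s` as `s (s i (k a)) (k b)`; the projections
are `⟨x⟩ x T` and `⟨x⟩ x F`. -/
def pair (a b : A) : A := sc (sc (ic A) (kc a)) (kc b)

/-- The code `[u₀, …, uₙ]` of a finite sequence: `[] = p T i` and `[a] * u = p F (p a u)`. -/
def tuple : List A → A
  | [] => pair (tt A) (ic A)
  | a :: u => pair (ff A) (pair a (tuple u))

end Coding

section Oracle

variable {A : Type u} [PCA A]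

/-- `u = [u₀, …, uₙ₋₁]` is an `f`-dialogue between `a` and `b`: for each `i` there is `v` with
`a ([b] * [u₀, …, uᵢ₋₁]) = p F v` and `f(v) = uᵢ`. The partial function `f` is given by its graph:
`f v w` says that `f(v)` is defined and equal to `w`. -/
def IsDialogue (f : A → A → Prop) (a b : A) (u : List A) : Prop :=
  ∀ (i : ℕ) (hi : i < u.length), ∃ v : A,
    pair (ff A) v ∈ PartialApplicative.app a (tuple (b :: u.take i)) ∧ f v u[i]

/-- The graph of the application of `A[f]`: `OracleApp f a b c` says that `a ·ᶠ b` is defined and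
equal to `c`, that is, some `f`-dialogue `u` between `a` and `b` halts, `a ([b] * u) = p T c`. -/
def OracleApp (f : A → A → Prop) (a b c : A) : Prop :=
  ∃ u : List A, IsDialogue f a b u ∧
    pair (tt A) c ∈ PartialApplicative.app a (tuple (b :: u))

/-- The stages `f_α` (as graphs) of the oracle for a total functional `F`: `f₀ = ∅`;
`f_{α+1}(a) = b` iff there is a total `g` of which `a` is an index in `A[f_α]`, with `F(g) = b`;
unions at limits. -/
noncomputable def stage (F : (A → A) → A) (α : Ordinal.{u}) : A → A → Prop :=
  Ordinal.limitRecOn (motive := fun _ => A → A → Prop) α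
    (fun _ _ => False)
    (fun _ f a b => ∃ g : A → A, (∀ w, OracleApp f a w (g w)) ∧ F g = b)
    (fun l _ f a b => ∃ (β : Ordinal.{u}) (hβ : β < l), f β hβ a b)

/-- The oracle `f = ⋃_α f_α`. -/
def oracle (F : (A → A) → A) (a b : A) : Prop :=
  ∃ α : Ordinal.{u}, stage F α a b

/-- The graph of the application `a ·^F b = c` of the pca `A[F] = A[f]`. -/
def FunctionalApp (F : (A → A) → A) (a b c : A) : Prop :=
  OracleApp (oracle F) a b c

/-- `m` witnesses that the identity `A → A[F]` is computationally dense: for each `b` there is `a`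
such that, whenever `b ·^F a'` is defined, `a a'` and `m ·^F (a a')` are defined and
`m ·^F (a a') = b ·^F a'`. -/
def IsDensityWitness (F : (A → A) → A) (m : A) : Prop :=
  ∀ b : A, ∃ a : A, ∀ a' c : A, FunctionalApp F b a' c →
    ∃ d ∈ PartialApplicative.app a a', FunctionalApp F m d c

/-- `J_F(P) = {a | m ·^F a ∈ P}`. -/
def functionalOperator (F : (A → A) → A) (m : A) (P : Set A) : Set A :=
  {a | ∃ c ∈ P, FunctionalApp F m a c}

end Oracle

section LocalOperators

variable {A : Type u} [PCA A]

/-- `P → Q = {a | ∀ b ∈ P, ab ↓ and ab ∈ Q}`. -/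
def arrow (P Q : Set A) : Set A :=
  {a | ∀ b ∈ P, ∃ c ∈ PartialApplicative.app a b, c ∈ Q}

/-- Local operators on (the realizability topos of) `A`. -/
def IsLocalOperator (J : Set A → Set A) : Prop :=
  (∃ e₁ : A, ∀ P : Set A, e₁ ∈ arrow P (J P)) ∧
  (∃ e₂ : A, ∀ P : Set A, e₂ ∈ arrow (J (J P)) (J P)) ∧
  (∃ e₃ : A, ∀ P Q : Set A, e₃ ∈ arrow (arrow P Q) (arrow (J P) (J Q)))

/-- The preorder `J ≤ J'` on local operators. -/
def LocalOperatorLE (J J' : Set A → Set A) : Prop :=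
  ∃ e : A, ∀ P : Set A, e ∈ arrow (J P) (J' P)

variable (A) in
/-- An assembly: a set `X` with a total relation `E` from `X` to `A`. -/
structure Assembly where
  X : Type u
  E : X → Set A
  total : ∀ x, (E x).Nonempty

/-- `t` tracks `f` as a morphism of `J`-assemblies. -/
def Tracks (J : Set A → Set A) (S T : Assembly A) (f : S.X → T.X) (t : A) : Prop :=
  ∀ x : S.X, t ∈ arrow (S.E x) (J (T.E (f x)))

/-- `f` is a morphism of `J`-assemblies. -/
def IsMorphism (J : Set A → Set A) (S T : Assembly A) (f : S.X → T.X) : Prop :=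
  ∃ t : A, Tracks J S T f t

/-- The exponential `T ^ S` of `J`-assemblies: the morphisms `S → T`, realized by what tracks them. -/
def Assembly.exp (J : Set A → Set A) (S T : Assembly A) : Assembly A where
  X := {f : S.X → T.X // IsMorphism J S T f}
  E f := {t | Tracks J S T f.1 t}
  total f := f.2

variable (A) in
/-- The assembly `𝐀 = (A, id)`. -/
def Assembly.base : Assembly A where
  X := A
  E a := {a}
  total a := Set.singleton_nonempty a

/-- `F` defines a morphism `𝐀 ^ 𝐀 → 𝐀` of `J`-assemblies. -/
def DefinesMorphism (J : Set A → Set A) (F : (A → A) → A) : Prop :=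
  IsMorphism J (Assembly.exp J (Assembly.base A) (Assembly.base A)) (Assembly.base A)
    (fun f => F f.1)

end LocalOperators

end Realizability

/-! An element of `J_F(P)` is a code, read by `m`, of an `A[F]`-computation with result in `P`.
Density, made uniform in the index by `IsDensityWitness.exists_uniform`, turns every
`A[F]`-computation into such a code by one element of `A`. The axioms for `J_F` then reduce to
composing in `A[F]`, with indices computed in `A` (`exists_comp`). A function tracked for `J_F` is
total with an index in `A[F]`; by `oracle_of_index` the oracle answers that index with the value of
`F`.

For minimality, let `φ` realize `F` for `J`. Dialogues can be simulated inside `J` once the oracle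
is realized there (`exists_simulation`). The recursion theorem gives `h` with `h v = φ (n h v)`,
where `n` is the simulator; induction on stages shows that `h` realizes the oracle in `J`
(`exists_realizes_oracle`). Simulating `m` then gives `J_F ≤ J`. -/

namespace Realizability

/-! ### Combinatory completeness and the recursion theorem -/

section Terms

variable {A : Type u} [PCA A]

theorem mem_papp {t s : Part A} {d : A} :
    d ∈ t ⬝ₚ s ↔ ∃ a ∈ t, ∃ b ∈ s, d ∈ PartialApplicative.app a b := by
  simp [papp, Part.mem_bind_iff]

theorem some_papp_some (a b : A) :
    Part.some a ⬝ₚ Part.some b = PartialApplicative.app a b := by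
  simp [papp]

theorem k_papp (a : A) : Part.some PCA.k ⬝ₚ Part.some a = Part.some (kc a) :=
  (Part.some_get _).symm

theorem s_papp (a b : A) :
    Part.some PCA.s ⬝ₚ Part.some a ⬝ₚ Part.some b = Part.some (sc a b) :=
  (Part.some_get _).symm

theorem mem_app_k (a : A) : kc a ∈ PartialApplicative.app PCA.k a := by
  rw [← some_papp_some, k_papp]; exact Part.mem_some _

theorem mem_app_kc (a b : A) : a ∈ PartialApplicative.app (kc a) b := by
  rw [← some_papp_some, ← k_papp, PCA.k_eq]; exact Part.mem_some _

theorem mem_app_sc {a b c u v d : A} (hu : u ∈ PartialApplicative.app a c)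
    (hv : v ∈ PartialApplicative.app b c) (hd : d ∈ PartialApplicative.app u v) :
    d ∈ PartialApplicative.app (sc a b) c := by
  rw [← some_papp_some, ← s_papp]
  apply PCA.s_app
  rw [some_papp_some, some_papp_some]
  exact mem_papp.2 ⟨u, hu, v, hv, hd⟩

theorem mem_app_ic (a : A) : a ∈ PartialApplicative.app (ic A) a :=
  mem_app_sc (mem_app_k a) (mem_app_k a) (mem_app_kc a _)

theorem mem_app_tt (a : A) : kc a ∈ PartialApplicative.app (tt A) a := mem_app_k a

theorem mem_app_ff (a : A) : ic A ∈ PartialApplicative.app (ff A) a := mem_app_kc _ a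

theorem mem_app_pair {a b z y d : A} (hy : y ∈ PartialApplicative.app z a)
    (hd : d ∈ PartialApplicative.app y b) : d ∈ PartialApplicative.app (pair a b) z :=
  mem_app_sc (mem_app_sc (mem_app_ic z) (mem_app_kc a z) hy) (mem_app_kc b z) hd

theorem mem_app_pair_tt (a b : A) : a ∈ PartialApplicative.app (pair a b) (tt A) :=
  mem_app_pair (mem_app_tt a) (mem_app_kc a b)

theorem mem_app_pair_ff (a b : A) : b ∈ PartialApplicative.app (pair a b) (ff A) :=
  mem_app_pair (mem_app_ff a) (mem_app_ic b)

variable (A) in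
/-- Applicative terms over `A`, with de Bruijn variables. -/
inductive Term : Type u
  | var (n : ℕ) : Term
  | const (a : A) : Term
  | app (t u : Term) : Term

/-- The environment `ρ` extended by a value for the variable `0`. -/
def extend (x : A) (ρ : ℕ → A) : ℕ → A
  | 0 => x
  | n + 1 => ρ n

namespace Term

/-- The denotation of a term in an environment. -/
def eval (ρ : ℕ → A) : Term A → Part A
  | var n => Part.some (ρ n)
  | const a => Part.some a
  | app t u => eval ρ t ⬝ₚ eval ρ u

/-- Bracket abstraction of the variable `0`. -/
def lam : Term A → Term A
  | var 0 => const (ic A)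
  | var (n + 1) => app (const PCA.k) (var n)
  | const a => app (const PCA.k) (const a)
  | app t u => app (app (const PCA.s) (lam t)) (lam u)

/-- The value of the abstraction of a term in an environment. -/
def closure (ρ : ℕ → A) : Term A → A
  | var 0 => ic A
  | var (n + 1) => kc (ρ n)
  | const a => kc a
  | app t u => sc (closure ρ t) (closure ρ u)

theorem eval_lam (ρ : ℕ → A) : ∀ t : Term A, (lam t).eval ρ = Part.some (t.closure ρ)
  | var 0 => rfl
  | var (n + 1) => k_papp _
  | const a => k_papp a
  | app t u => by
    simp only [lam, eval, closure, eval_lam ρ t, eval_lam ρ u, s_papp]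

variable {ρ : ℕ → A}

theorem mem_var (n : ℕ) : ρ n ∈ (var n).eval ρ := Part.mem_some _

theorem mem_const (a : A) : a ∈ (const a).eval ρ := Part.mem_some _

theorem mem_app {t u : Term A} {a b d : A} (ha : a ∈ t.eval ρ) (hb : b ∈ u.eval ρ)
    (hd : d ∈ PartialApplicative.app a b) : d ∈ (app t u).eval ρ :=
  mem_papp.2 ⟨a, ha, b, hb, hd⟩

theorem mem_lam (t : Term A) : t.closure ρ ∈ (lam t).eval ρ := by
  rw [eval_lam]; exact Part.mem_some _

/-- Only an implication: `s a b c` may be defined when `a c (b c)` is not. -/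
theorem mem_app_closure {x : A} : ∀ {t : Term A} {d : A}, d ∈ t.eval (extend x ρ) →
    d ∈ PartialApplicative.app (t.closure ρ) x
  | var 0, d, h => by
    obtain rfl : d = x := Part.mem_some_iff.1 h
    exact mem_app_ic d
  | var (n + 1), d, h => by
    obtain rfl : d = ρ n := Part.mem_some_iff.1 h
    exact mem_app_kc _ x
  | const a, d, h => by
    obtain rfl : d = a := Part.mem_some_iff.1 h
    exact mem_app_kc _ x
  | app t u, d, h => by
    obtain ⟨a, ha, b, hb, hd⟩ := mem_papp.1 h
    exact mem_app_sc (mem_app_closure ha) (mem_app_closure hb) hd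

/-- First projection. -/
def fst (t : Term A) : Term A := app t (const (tt A))

/-- Second projection. -/
def snd (t : Term A) : Term A := app t (const (ff A))

/-- Pairing. -/
def mkPair (t u : Term A) : Term A :=
  app (app (const PCA.s) (app (app (const PCA.s) (const (ic A))) (app (const PCA.k) t)))
    (app (const PCA.k) u)

/-- Adding an element at the head of a coded sequence. -/
def cons (t u : Term A) : Term A := mkPair (const (ff A)) (mkPair t u)

/-- Case distinction on the first component of a pair; the second one is bound to the variable `0`
in the branches. -/
def cases (t u v : Term A) : Term A := app (app (app (fst t) (lam u)) (lam v)) (snd t)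

theorem mem_fst {t : Term A} {a b : A} (h : pair a b ∈ t.eval ρ) : a ∈ (fst t).eval ρ :=
  mem_app h (mem_const _) (mem_app_pair_tt a b)

theorem mem_snd {t : Term A} {a b : A} (h : pair a b ∈ t.eval ρ) : b ∈ (snd t).eval ρ :=
  mem_app h (mem_const _) (mem_app_pair_ff a b)

theorem mem_mkPair {t u : Term A} {a b : A} (ha : a ∈ t.eval ρ) (hb : b ∈ u.eval ρ) :
    pair a b ∈ (mkPair t u).eval ρ := by
  have ht := Part.eq_some_iff.2 ha
  have hu := Part.eq_some_iff.2 hb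
  simp only [mkPair, eval, ht, hu, k_papp, s_papp]
  exact Part.mem_some _

theorem mem_cons {t u : Term A} {a : A} {l : List A} (ha : a ∈ t.eval ρ)
    (hl : tuple l ∈ u.eval ρ) : tuple (a :: l) ∈ (cons t u).eval ρ :=
  mem_mkPair (mem_const _) (mem_mkPair ha hl)

theorem mem_head {t : Term A} {a : A} {l : List A} (h : tuple (a :: l) ∈ t.eval ρ) :
    a ∈ (fst (snd t)).eval ρ :=
  mem_fst (mem_snd h)

theorem mem_tail {t : Term A} {a : A} {l : List A} (h : tuple (a :: l) ∈ t.eval ρ) :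
    tuple l ∈ (snd (snd t)).eval ρ :=
  mem_snd (mem_snd h)

/-- Both branches are abstractions and so always denote; the body of the branch not taken may be
undefined. -/
theorem mem_cases_tt {t u v : Term A} {a d : A} (ht : pair (tt A) a ∈ t.eval ρ)
    (hd : d ∈ u.eval (extend a ρ)) : d ∈ (cases t u v).eval ρ :=
  mem_app (mem_app (mem_app (mem_fst ht) (mem_lam u) (mem_app_tt _)) (mem_lam v)
    (mem_app_kc _ _)) (mem_snd ht) (mem_app_closure hd)

theorem mem_cases_ff {t u v : Term A} {a d : A} (ht : pair (ff A) a ∈ t.eval ρ)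
    (hd : d ∈ v.eval (extend a ρ)) : d ∈ (cases t u v).eval ρ :=
  mem_app (mem_app (mem_app (mem_fst ht) (mem_lam u) (mem_app_ff _)) (mem_lam v)
    (mem_app_ic _)) (mem_snd ht) (mem_app_closure hd)

/-- Recursion theorem: in `t`, the variable `0` stands for the element `a` being defined and the
variable `1` for its argument. -/
theorem exists_fixpoint (ρ : ℕ → A) (t : Term A) : ∃ a w : A, ∀ x d : A,
    d ∈ t.eval (extend a (extend x (extend w ρ))) → d ∈ PartialApplicative.app a x := by
  let body : Term A := app (lam t) (app (var 1) (var 1))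
  -- The self-application `w w` evaluates to the fixed point, which `body` passes to the abstraction
  -- of `t`.
  let w : A := (lam body).closure ρ
  have hw : body.closure (extend w ρ) ∈ PartialApplicative.app w w :=
    mem_app_closure (mem_lam body)
  exact ⟨body.closure (extend w ρ), w, fun x d hd => mem_app_closure
    (mem_app (mem_lam t) (mem_app (mem_var 1) (mem_var 1) hw) (mem_app_closure hd))⟩

end Term

end Terms

/-! ### Dialogues and uniform programming in `A[f]` -/

section Dialogues

variable {A : Type u} [PCA A]

/-- `Run f a c p u`: when `a` has received the sequence `p`, it continues by asking questions whose
answers according to `f` are `u`, and then halts with output `c`. -/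
def Run (f : A → A → Prop) (a c : A) : List A → List A → Prop
  | p, [] => pair (tt A) c ∈ PartialApplicative.app a (tuple p)
  | p, w :: u => ∃ v, pair (ff A) v ∈ PartialApplicative.app a (tuple p) ∧ f v w ∧
      Run f a c (p ++ [w]) u

/-- Induction on the answers lengthens the sequence already received, so that sequence has to be a
parameter; dialogues are the case `p = [b]`. -/
theorem run_iff {f : A → A → Prop} {a c : A} (u : List A) : ∀ p : List A, Run f a c p u ↔
    (∀ (i : ℕ) (hi : i < u.length), ∃ v : A,
      pair (ff A) v ∈ PartialApplicative.app a (tuple (p ++ u.take i)) ∧ f v u[i]) ∧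
    pair (tt A) c ∈ PartialApplicative.app a (tuple (p ++ u)) := by
  induction u with
  | nil => intro p; simp [Run]
  | cons w u ih =>
    intro p
    simp only [Run, ih]
    constructor
    · rintro ⟨v, hv, hf, h, hc⟩
      refine ⟨fun i hi => ?_, by simpa using hc⟩
      cases i with
      | zero => exact ⟨v, by simpa using hv, hf⟩
      | succ i => simpa using h i (by simpa using hi)
    · rintro ⟨h, hc⟩
      obtain ⟨v, hv, hf⟩ := h 0 (by simp)
      refine ⟨v, by simpa using hv, hf, fun i hi => ?_, by simpa using hc⟩
      rw [List.append_assoc]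
      exact h (i + 1) (by simpa using hi)

theorem oracleApp_iff {f : A → A → Prop} {a b c : A} :
    OracleApp f a b c ↔ ∃ u, Run f a c [b] u := by
  simp only [run_iff]; rfl

theorem Run.mono {f f' : A → A → Prop} {a c : A} (u : List A) : ∀ {p : List A},
    (∀ v w, w ∈ u → f v w → f' v w) → Run f a c p u → Run f' a c p u := by
  induction u with
  | nil => intro p _ h; exact h
  | cons w u ih =>
    rintro p hf ⟨v, hv, hvw, h⟩
    exact ⟨v, hv, hf v w (by simp) hvw, ih (fun v w hw => hf v w (by simp [hw])) h⟩

theorem OracleApp.mono {f f' : A → A → Prop} (hf : ∀ v w, f v w → f' v w) {a b c : A}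
    (h : OracleApp f a b c) : OracleApp f' a b c := by
  obtain ⟨u, h⟩ := oracleApp_iff.1 h
  exact oracleApp_iff.2 ⟨u, h.mono u fun v w _ => hf v w⟩

/-- If `a'` behaves on sequences that start with `p'` as `a` does on those that start with `p`,
then it has the same dialogues. -/
theorem Run.transfer {f : A → A → Prop} {a a' c : A} {p p' : List A}
    (h : ∀ u o, o ∈ PartialApplicative.app a (tuple (p ++ u)) →
      o ∈ PartialApplicative.app a' (tuple (p' ++ u))) (u : List A) :
    ∀ q, Run f a c (p ++ q) u → Run f a' c (p' ++ q) u := by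
  induction u with
  | nil => intro q hq; exact h q _ hq
  | cons w u ih =>
    rintro q ⟨v, hv, hf, hr⟩
    refine ⟨v, h q _ hv, hf, ?_⟩
    rw [List.append_assoc] at hr ⊢
    exact ih _ hr

theorem OracleApp.transfer {f : A → A → Prop} {a a' b b' c : A}
    (h : ∀ u o, o ∈ PartialApplicative.app a (tuple (b :: u)) →
      o ∈ PartialApplicative.app a' (tuple (b' :: u)))
    (hc : OracleApp f a b c) : OracleApp f a' b' c := by
  obtain ⟨u, hu⟩ := oracleApp_iff.1 hc
  exact oracleApp_iff.2 ⟨u, Run.transfer (p := [b]) (p' := [b']) h u [] hu⟩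

open Term

variable (A) in
/-- An element that evaluates `b ·ᶠ x` on input `p b x`, for all oracles `f`. -/
theorem exists_universal : ∃ m : A, ∀ (f : A → A → Prop) (b x c : A),
    OracleApp f b x c → OracleApp f m (pair b x) c := by
  let t : Term A := app (fst (fst (snd (var 0))))
    (cons (snd (fst (snd (var 0)))) (snd (snd (var 0))))
  refine ⟨t.closure fun _ => ic A, fun f b x c h => h.transfer fun u o ho => mem_app_closure ?_⟩
  have hl : tuple (pair b x :: u) ∈ (var 0).eval (extend (tuple (pair b x :: u)) fun _ => ic A) :=
    mem_var 0
  exact mem_app (mem_fst (mem_head hl)) (mem_cons (mem_snd (mem_head hl)) (mem_tail hl)) ho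

variable (A) in
/-- The elements of `A` are computable functions in `A[f]`, uniformly. -/
theorem exists_lift : ∃ e : A, ∀ t : A, ∃ r ∈ PartialApplicative.app e t,
    ∀ (f : A → A → Prop) (x y : A), y ∈ PartialApplicative.app t x → OracleApp f r x y := by
  let b : Term A := mkPair (const (tt A)) (app (var 1) (fst (snd (var 0))))
  refine ⟨(lam b).closure fun _ => ic A, fun t => ⟨_, mem_app_closure (mem_lam b),
    fun f x y hy => oracleApp_iff.2 ⟨[], ?_⟩⟩⟩
  have hl : tuple [x] ∈ (var 0).eval (extend (tuple [x]) (extend t fun _ => ic A)) := mem_var 0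
  exact mem_app_closure (mem_mkPair (mem_const _) (mem_app (mem_var 1) (mem_head hl) hy))

/-- Precomposition with an element of `A`, uniformly. -/
theorem exists_precomp (m : A) : ∃ e : A, ∀ t : A, ∃ r ∈ PartialApplicative.app e t,
    ∀ (f : A → A → Prop) (x y c : A), y ∈ PartialApplicative.app t x →
      OracleApp f m y c → OracleApp f r x c := by
  let b : Term A := app (const m) (cons (app (var 1) (fst (snd (var 0)))) (snd (snd (var 0))))
  refine ⟨(lam b).closure fun _ => ic A, fun t => ⟨_, mem_app_closure (mem_lam b),
    fun f x y c hy hc => hc.transfer fun u o ho => mem_app_closure ?_⟩⟩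
  have hl : tuple (x :: u) ∈ (var 0).eval (extend (tuple (x :: u)) (extend t fun _ => ic A)) :=
    mem_var 0
  exact mem_app (mem_const m) (mem_cons (mem_app (mem_var 1) (mem_head hl) hy) (mem_tail hl)) ho

/-- `d` prepends the sequence `p`. -/
def Prepends (d : A) (p : List A) : Prop :=
  ∀ z : List A, tuple (p ++ z) ∈ PartialApplicative.app d (tuple z)

theorem prepends_closure {ρ : ℕ → A} {t u : Term A} {d w : A} {p : List A}
    (hd : Prepends d p) (ht : ∀ z, d ∈ t.eval (extend z ρ)) (hu : ∀ z, w ∈ u.eval (extend z ρ)) :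
    Prepends ((app t (cons u (var 0))).closure ρ) (p ++ [w]) := fun z => by
  rw [List.append_assoc]
  exact mem_app_closure (mem_app (ht _) (mem_cons (hu _) (mem_var 0)) (hd (w :: z)))

theorem prepends_singleton {ρ : ℕ → A} {u : Term A} {w : A}
    (hu : ∀ z, w ∈ u.eval (extend z ρ)) : Prepends ((cons u (var 0)).closure ρ) [w] :=
  fun _ => mem_app_closure (mem_cons (hu _) (mem_var 0))

/-- The recursion step for composition: `g r d z`, where `d` prepends the sequence `p` that `q` has
received, and `z` is the rest of the available sequence. -/
theorem exists_comp_aux (q : A) : ∃ g : A, ∀ r : A, ∃ g₁ ∈ PartialApplicative.app g r, ∀ d : A,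
    ∃ g₂ ∈ PartialApplicative.app g₁ d, ∀ p : List A, Prepends d p →
      (∀ c, pair (tt A) c ∈ PartialApplicative.app q (tuple p) → ∀ z o,
        o ∈ PartialApplicative.app r (tuple (c :: z)) →
        o ∈ PartialApplicative.app g₂ (tuple z)) ∧
      (∀ v, pair (ff A) v ∈ PartialApplicative.app q (tuple p) →
        pair (ff A) v ∈ PartialApplicative.app g₂ (tuple []) ∧
        ∀ w z, ∃ d', Prepends d' (p ++ [w]) ∧ ∀ g₃ ∈ PartialApplicative.app g₁ d', ∀ o,
          o ∈ PartialApplicative.app g₃ (tuple z) →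
          o ∈ PartialApplicative.app g₂ (tuple (w :: z))) := by
  -- variables: `z = 0`, `d = 1`, `g = 2`, `r = 3`
  let b : Term A := cases (app (const q) (app (var 1) (const (tuple []))))
    (app (var 4) (cons (var 0) (var 1)))
    (cases (var 1) (mkPair (const (ff A)) (var 1)) (app (app (app (var 4) (var 5))
      (lam (app (var 4) (cons (fst (var 1)) (var 0))))) (snd (var 0))))
  -- If `q` halts with `c`, `r` runs on `c` and the remaining answers. If `q` asks `v`, then `v` is
  -- asked when no answer remains; otherwise the next answer is moved into the prefix and the
  -- recursion continues.
  obtain ⟨g, y, hg⟩ := exists_fixpoint (fun _ => ic A) (lam (lam b))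
  refine ⟨g, fun r => ⟨_, hg r _ (mem_lam _), fun d => ⟨_, mem_app_closure (mem_lam b),
    fun p hp => ⟨fun c hc z o ho => ?_, fun v hv => ⟨?_, fun w z => ?_⟩⟩⟩⟩⟩
  · have hp' := hp []
    rw [List.append_nil] at hp'
    exact mem_app_closure (mem_cases_tt
      (mem_app (mem_const q) (mem_app (mem_var 1) (mem_const _) hp') hc)
      (mem_app (mem_var 4) (mem_cons (mem_var 0) (mem_var 1)) ho))
  · have hp' := hp []
    rw [List.append_nil] at hp'
    exact mem_app_closure (mem_cases_ff
      (mem_app (mem_const q) (mem_app (mem_var 1) (mem_const _) hp') hv)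
      (mem_cases_tt (mem_var 1) (mem_mkPair (mem_const _) (mem_var 1))))
  · have hp' := hp []
    rw [List.append_nil] at hp'
    refine ⟨_, prepends_closure (w := w) hp (fun _ => mem_var 4)
      (fun _ => mem_fst (b := tuple z) (mem_var 1)),
      fun g₃ hg₃ o ho => mem_app_closure (mem_cases_ff
        (mem_app (mem_const q) (mem_app (mem_var 1) (mem_const _) hp') hv)
        (mem_cases_ff (mem_var 1) (mem_app (mem_app (mem_app (mem_var 4) (mem_var 5)
          (hg r _ (mem_lam _))) (mem_lam _) hg₃) (mem_snd (mem_var 0)) ho)))⟩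

/-- Composition in `A[f]`, uniformly in the second factor. -/
theorem exists_comp (q : A) : ∃ e : A, ∀ r : A, ∃ s ∈ PartialApplicative.app e r,
    ∀ (f : A → A → Prop) (a b c : A), OracleApp f q a b → OracleApp f r b c →
      OracleApp f s a c := by
  obtain ⟨g, hg⟩ := exists_comp_aux q
  let t : Term A := app (app (app (const g) (var 1))
    (lam (cons (fst (snd (var 1))) (var 0)))) (snd (snd (var 0)))
  refine ⟨(lam t).closure fun _ => ic A, fun r => ⟨_, mem_app_closure (mem_lam t),
    fun f a b c hq hr => ?_⟩⟩
  obtain ⟨g₁, hg₁, hrec⟩ := hg r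
  set s : A := t.closure (extend r fun _ => ic A)
  obtain ⟨u', hr⟩ := oracleApp_iff.1 hr
  obtain ⟨u, hq⟩ := oracleApp_iff.1 hq
  -- The questions of `q` come first, then those of `r`.
  refine oracleApp_iff.2 ⟨u ++ u', ?_⟩
  have start : ∀ z o, (∀ d, Prepends d [a] → ∀ g₂ ∈ PartialApplicative.app g₁ d,
      o ∈ PartialApplicative.app g₂ (tuple z)) → o ∈ PartialApplicative.app s (tuple (a :: z)) := by
    intro z o h
    have hl : tuple (a :: z) ∈ (var 0).eval (extend (tuple (a :: z)) (extend r fun _ => ic A)) :=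
      mem_var 0
    let d : A := (cons (fst (snd (var 1))) (var 0)).closure
      (extend (tuple (a :: z)) (extend r fun _ => ic A))
    obtain ⟨g₂, hg₂, -⟩ := hrec d
    have hd : Prepends d [a] :=
      prepends_singleton fun y => mem_head (l := z) (mem_var 1)
    exact mem_app_closure (mem_app (mem_app (mem_app (mem_const g) (mem_var 1) hg₁)
      (mem_lam _) hg₂) (mem_tail hl) (h d hd g₂ hg₂))
  -- Invariant: beyond `a :: p`, `s` acts as the recursion does with `a :: p` absorbed into the
  -- prefix.
  have main : ∀ u p, Run f q b (a :: p) u →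
      (∀ z o, (∀ d, Prepends d (a :: p) → ∀ g₂ ∈ PartialApplicative.app g₁ d,
        o ∈ PartialApplicative.app g₂ (tuple z)) →
        o ∈ PartialApplicative.app s (tuple (a :: p ++ z))) →
      Run f s c (a :: p) (u ++ u') := by
    intro u
    induction u with
    | nil =>
      intro p hq hs
      have := Run.transfer (a := r) (a' := s) (p := [b]) (p' := a :: p) (c := c) (f := f)
        (fun z o ho => hs z o fun d hd g₂ hg₂ => ?_) u' []
      · simpa using this (by simpa using hr)
      · obtain ⟨g₂', hg₂', h⟩ := hrec d
        obtain rfl := Part.mem_unique hg₂ hg₂'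
        exact (h _ hd).1 b hq z o ho
    | cons w u ih =>
      rintro p ⟨v, hv, hf, hq⟩ hs
      refine ⟨v, ?_, hf, ih (p ++ [w]) hq fun z o ho => ?_⟩
      · have := hs [] (pair (ff A) v) fun d hd g₂ hg₂ => ?_
        · simpa using this
        · obtain ⟨g₂', hg₂', h⟩ := hrec d
          obtain rfl := Part.mem_unique hg₂ hg₂'
          exact ((h _ hd).2 v hv).1
      · have := hs (w :: z) o fun d hd g₂ hg₂ => ?_
        · simpa using this
        · obtain ⟨g₂', hg₂', h⟩ := hrec d
          obtain rfl := Part.mem_unique hg₂ hg₂'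
          obtain ⟨d', hd', h'⟩ := ((h _ hd).2 v hv).2 w z
          obtain ⟨g₃, hg₃, -⟩ := hrec d'
          exact h' g₃ hg₃ o (ho d' hd' g₃ hg₃)
  exact main u [] hq start

variable (A) in
/-- An element that asks the oracle the question `w` obtained from its argument `t`. -/
theorem exists_query (e : A) : ∃ b : A, ∀ (f : A → A → Prop) (t w c : A),
    w ∈ PartialApplicative.app e t → f w c → OracleApp f b t c := by
  let b : Term A := cases (snd (snd (var 0)))
    (mkPair (const (ff A)) (app (const e) (fst (snd (var 1)))))
    (mkPair (const (tt A)) (fst (var 0)))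
  refine ⟨b.closure fun _ => ic A, fun f t w c hw hf => oracleApp_iff.2 ⟨[c], w, ?_, hf, ?_⟩⟩
  · have h₀ : tuple [t] ∈ (var 0).eval (extend (tuple [t]) fun _ => ic A) := mem_var 0
    exact mem_app_closure (mem_cases_tt (mem_tail h₀)
      (mem_mkPair (mem_const _) (mem_app (mem_const e) (mem_head (l := []) (mem_var 1)) hw)))
  · have h₀ : tuple [t, c] ∈ (var 0).eval (extend (tuple [t, c]) fun _ => ic A) := mem_var 0
    exact mem_app_closure (mem_cases_ff (mem_tail h₀)
      (mem_mkPair (mem_const _) (mem_fst (mem_var 0))))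

end Dialogues

/-! ### The stages of the oracle -/

section Stages

variable {A : Type u} [PCA A] (F : (A → A) → A)

theorem stage_zero : stage F 0 = fun _ _ => False := by
  simp [stage]

theorem stage_add_one (α : Ordinal.{u}) : stage F (α + 1) = fun a b =>
    ∃ g : A → A, (∀ w, OracleApp (stage F α) a w (g w)) ∧ F g = b := by
  unfold stage
  rw [Ordinal.limitRecOn_add_one]

theorem stage_limit {l : Ordinal.{u}} (hl : Order.IsSuccLimit l) :
    stage F l = fun a b => ∃ β, ∃ _ : β < l, stage F β a b := by
  unfold stage
  rw [Ordinal.limitRecOn_limit _ _ _ _ hl]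

/-- Treating all ordinals alike yields monotonicity at once and suits well-founded induction. -/
theorem stage_iff (α : Ordinal.{u}) : ∀ a b : A, stage F α a b ↔
    ∃ β < α, ∃ g : A → A, (∀ w, OracleApp (stage F β) a w (g w)) ∧ F g = b := by
  induction α using WellFoundedLT.induction with
  | ind α ih =>
  intro a b
  obtain rfl | ⟨α, rfl⟩ | hl := Ordinal.zero_or_succ_or_isSuccLimit α
  · simp [stage_zero]
  · rw [Order.succ_eq_add_one] at ih ⊢
    rw [stage_add_one]
    constructor
    · rintro ⟨g, hg⟩
      exact ⟨α, Order.lt_add_one_iff.2 le_rfl, g, hg⟩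
    · rintro ⟨β, hβ, g, hg, hb⟩
      -- Monotonicity from `β` to `α` comes from the induction hypothesis at both.
      refine ⟨g, fun w => (hg w).mono fun v y h => ?_, hb⟩
      obtain ⟨γ, hγ, h⟩ := (ih β hβ v y).1 h
      exact (ih α (Order.lt_add_one_iff.2 le_rfl) v y).2
        ⟨γ, hγ.trans_le (Order.lt_add_one_iff.1 hβ), h⟩
  · rw [stage_limit F hl]
    constructor
    · rintro ⟨β, hβ, h⟩
      obtain ⟨γ, hγ, h⟩ := (ih β hβ a b).1 h
      exact ⟨γ, hγ.trans hβ, h⟩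
    · rintro ⟨β, hβ, h⟩
      refine ⟨β + 1, hl.add_one_lt hβ, ?_⟩
      rw [stage_add_one]
      exact h

theorem stage_mono {α β : Ordinal.{u}} (h : α ≤ β) (a b : A) (hα : stage F α a b) :
    stage F β a b := by
  obtain ⟨γ, hγ, hg⟩ := (stage_iff F α a b).1 hα
  exact (stage_iff F β a b).2 ⟨γ, hγ.trans_le h, hg⟩

/-- A dialogue is finite, so the maximum of the stages of its answers suffices. -/
theorem Run.exists_stage {a c : A} (u : List A) : ∀ {p : List A},
    Run (oracle F) a c p u → ∃ α : Ordinal.{u}, Run (stage F α) a c p u := by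
  induction u with
  | nil => intro p h; exact ⟨0, h⟩
  | cons w u ih =>
    rintro p ⟨v, hv, ⟨β, hβ⟩, h⟩
    obtain ⟨α, hα⟩ := ih h
    exact ⟨max α β, v, hv, stage_mono F (le_max_right _ _) _ _ hβ,
      hα.mono u fun v w _ => stage_mono F (le_max_left _ _) v w⟩

/-- A total function with an index in `A[F]` has that index at some stage. -/
theorem oracle_of_index {t : A} {g : A → A} (h : ∀ w, FunctionalApp F t w (g w)) :
    oracle F t (F g) := by
  have hstage : ∀ w, ∃ α : Ordinal.{u}, OracleApp (stage F α) t w (g w) := by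
    intro w
    obtain ⟨l, hl⟩ := oracleApp_iff.1 (h w)
    obtain ⟨α, hα⟩ := hl.exists_stage F l
    exact ⟨α, oracleApp_iff.2 ⟨l, hα⟩⟩
  choose α hα using hstage
  -- The supremum exists because `A` lives in `Type u`; one stage later the oracle answers `t`.
  refine ⟨(⨆ w, α w) + 1, ?_⟩
  rw [stage_add_one]
  exact ⟨g, fun w => (hα w).mono (stage_mono F (Ordinal.le_iSup α w)), rfl⟩

end Stages

/-! ### Simulation inside a local operator, and minimality -/

section Minimality

variable {A : Type u} [PCA A]

open Term

/-- Given realizers for the local operator `J`, the dialogues with an oracle can be continued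
inside `J`, from an element `d` that prepends the sequence received so far. -/
theorem exists_simulation_aux {J : Set A → Set A} (hJ : IsLocalOperator J) :
    ∃ n : A, ∀ h : A, ∃ n₁ ∈ PartialApplicative.app n h, ∀ a : A,
      ∃ n₂ ∈ PartialApplicative.app n₁ a, ∀ f : A → A → Prop,
        (∀ v w, f v w → ∃ y ∈ PartialApplicative.app h v, y ∈ J {w}) →
        ∀ u d p c, Prepends d p → Run f a c p u →
          ∃ y ∈ PartialApplicative.app n₂ d, y ∈ J {c} := by
  obtain ⟨⟨e₁, h₁⟩, ⟨e₂, h₂⟩, ⟨e₃, h₃⟩⟩ := hJ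
  -- The answer `w` is known only through an element of `J {w}`. The continuation maps `{w}` to `J
  -- {c}`; `e₃` lifts it to `J {w} → J (J {c})` and `e₂` flattens the result. A halt is handled by
  -- `e₁`.
  let cont : Term A := app (app (app (var 4) (var 5)) (var 3))
    (lam (app (var 3) (cons (var 1) (var 0))))
  let body : Term A := cases (app (var 1) (app (var 0) (const (tuple []))))
    (app (const e₁) (var 0))
    (app (const e₂) (app (app (const e₃) (lam cont)) (app (var 4) (var 0))))
  obtain ⟨n, y, hn⟩ := exists_fixpoint (fun _ => ic A) (lam (lam body))
  refine ⟨n, fun h => ⟨_, hn h _ (mem_lam _), fun a => ⟨_, mem_app_closure (mem_lam body),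
    fun f hf u => ?_⟩⟩⟩
  induction u with
  | nil =>
    intro d p c hd hr
    have hd' := hd []
    rw [List.append_nil] at hd'
    obtain ⟨y, hy, hyJ⟩ := h₁ {c} c rfl
    exact ⟨y, mem_app_closure (mem_cases_tt
      (mem_app (mem_var 1) (mem_app (mem_var 0) (mem_const _) hd') hr)
      (mem_app (mem_const e₁) (mem_var 0) hy)), hyJ⟩
  | cons w u ih =>
    rintro d p c hd ⟨v, hv, hvw, hr⟩
    have hd' := hd []
    rw [List.append_nil] at hd'
    obtain ⟨x, hx, hxJ⟩ := hf v w hvw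
    let ρ : ℕ → A := extend v (extend d (extend a (extend n (extend h (extend y fun _ => ic A)))))
    have hcont : cont.closure ρ ∈ arrow {w} (J {c}) := by
      rintro _ rfl
      obtain ⟨o, ho, hoJ⟩ := ih _ _ c
        (prepends_closure (ρ := extend _ ρ) hd (fun _ => mem_var 3) (fun _ => mem_var 1)) hr
      exact ⟨o, mem_app_closure (mem_app (mem_app (mem_app (mem_var 4) (mem_var 5)
        (hn h _ (mem_lam _))) (mem_var 3) (mem_app_closure (mem_lam body))) (mem_lam _) ho), hoJ⟩
    obtain ⟨k, hk, hkJ⟩ := h₃ {w} (J {c}) _ hcont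
    obtain ⟨o, ho, hoJ⟩ := hkJ x hxJ
    obtain ⟨o', ho', hoJ'⟩ := h₂ {c} o hoJ
    exact ⟨o', mem_app_closure (mem_cases_ff
      (mem_app (mem_var 1) (mem_app (mem_var 0) (mem_const _) hd') hv)
      (mem_app (mem_const e₂) (mem_app (mem_app (mem_const e₃) (mem_lam cont) hk)
        (mem_app (mem_var 4) (mem_var 0) hx) ho) ho')), hoJ'⟩

/-- Given realizers for the local operator `J`, the dialogues with an oracle can be carried out
inside `J`: `n h a b ∈ J {c}` if `a ·ᶠ b = c` and `h` realizes the oracle `f`. -/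
theorem exists_simulation {J : Set A → Set A} (hJ : IsLocalOperator J) :
    ∃ n : A, ∀ h : A, ∃ n₁ ∈ PartialApplicative.app n h, ∀ a : A,
      ∃ n₂ ∈ PartialApplicative.app n₁ a, ∀ f : A → A → Prop,
        (∀ v w, f v w → ∃ y ∈ PartialApplicative.app h v, y ∈ J {w}) →
        ∀ b c, OracleApp f a b c → ∃ y ∈ PartialApplicative.app n₂ b, y ∈ J {c} := by
  obtain ⟨n, hn⟩ := exists_simulation_aux hJ
  let t : Term A := app (app (app (const n) (var 2)) (var 1)) (lam (cons (var 1) (var 0)))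
  refine ⟨(lam (lam t)).closure fun _ => ic A, fun h => ⟨_, mem_app_closure (mem_lam _),
    fun a => ⟨_, mem_app_closure (mem_lam t), fun f hf b c hc => ?_⟩⟩⟩
  obtain ⟨n₁, hn₁, hn⟩ := hn h
  obtain ⟨n₂, hn₂, hn⟩ := hn a
  obtain ⟨u, hu⟩ := oracleApp_iff.1 hc
  obtain ⟨y, hy, hyJ⟩ := hn f hf u _ [b] c (prepends_singleton
    (ρ := extend b (extend a (extend h fun _ => ic A))) (u := var 1) fun _ => mem_var 1) hu
  exact ⟨y, mem_app_closure (mem_app (mem_app (mem_app (mem_const n) (mem_var 2) hn₁)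
    (mem_var 1) hn₂) (mem_lam _) hy), hyJ⟩

variable {F : (A → A) → A}

/-- If `F` defines a morphism of `J`-assemblies, then its oracle is realized in `J`. -/
theorem exists_realizes_oracle {J : Set A → Set A} (hJ : IsLocalOperator J)
    (hF : DefinesMorphism J F) :
    ∃ h : A, ∀ v w, oracle F v w → ∃ y ∈ PartialApplicative.app h v, y ∈ J {w} := by
  obtain ⟨n, hn⟩ := exists_simulation hJ
  obtain ⟨φ, hφ⟩ := hF
  obtain ⟨h, _, hh⟩ := exists_fixpoint (fun _ => ic A)
    (app (const φ) (app (app (const n) (var 0)) (var 1)))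
  refine ⟨h, fun v w ⟨α, hα⟩ => ?_⟩
  induction α using WellFoundedLT.induction generalizing v w with
  | ind α ih =>
  obtain ⟨β, hβ, g, hg, rfl⟩ := (stage_iff F α v w).1 hα
  obtain ⟨n₁, hn₁, hn⟩ := hn h
  obtain ⟨n₂, hn₂, hn⟩ := hn v
  have ht : Tracks J (Assembly.base A) (Assembly.base A) g n₂ := by
    rintro x _ rfl
    -- The simulator does not depend on the oracle, so it may be used with the earlier stage `β`,
    -- where `h` is already known to be correct.
    exact hn _ (fun v w hvw => ih β hβ v w ⟨β, hvw⟩ hvw) _ _ (hg _)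
  obtain ⟨y, hy, hyJ⟩ := hφ ⟨g, n₂, ht⟩ n₂ ht
  exact ⟨y, hh v y (mem_app (mem_const φ) (mem_app (mem_app (mem_const n) (mem_var 0) hn₁)
    (mem_var 1) hn₂) hy), hyJ⟩

theorem functionalOperator_le {J : Set A → Set A} (hJ : IsLocalOperator J)
    (hF : DefinesMorphism J F) (m : A) : LocalOperatorLE (functionalOperator F m) J := by
  obtain ⟨h, hh⟩ := exists_realizes_oracle hJ hF
  obtain ⟨n, hn⟩ := exists_simulation hJ
  obtain ⟨n₁, hn₁, hn⟩ := hn h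
  obtain ⟨n₂, hn₂, hn⟩ := hn m
  obtain ⟨-, -, e₃, h₃⟩ := hJ
  refine ⟨(app (app (const e₃) (const (ic A))) (app (const n₂) (var 0))).closure fun _ => ic A,
    fun P a ⟨c, hc, ha⟩ => ?_⟩
  obtain ⟨y, hy, hyJ⟩ := hn _ hh a c ha
  -- As `c ∈ P`, the identity realizes `{c} → P`, which carries `J {c}` into `J P`.
  obtain ⟨k, hk, hkJ⟩ := h₃ {c} P (ic A) fun b hb => ⟨b, mem_app_ic b, by
    rwa [Set.mem_singleton_iff.1 hb]⟩
  obtain ⟨z, hz, hzJ⟩ := hkJ y hyJ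
  exact ⟨z, mem_app_closure (mem_app (mem_app (mem_const e₃) (mem_const _) hk)
    (mem_app (mem_const n₂) (mem_var 0) hy) hz), hzJ⟩

end Minimality

/-! ### Density, and the properties of `J_F` -/

section Density

variable {A : Type u} [PCA A] {F : (A → A) → A}

open Term

variable (F) in
theorem exists_isDensityWitness : ∃ m : A, IsDensityWitness F m := by
  obtain ⟨m, hm⟩ := exists_universal A
  refine ⟨m, fun b => ⟨(mkPair (const b) (var 0)).closure fun _ => ic A, fun x c h =>
    ⟨_, mem_app_closure (mem_mkPair (mem_const b) (mem_var 0)), hm _ b x c h⟩⟩⟩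

/-- Density, uniformly in the index `b`. -/
theorem IsDensityWitness.exists_uniform {m : A} (hm : IsDensityWitness F m) :
    ∃ e : A, ∀ b x c : A, FunctionalApp F b x c →
      ∃ d ∈ PartialApplicative.app e (pair b x), FunctionalApp F m d c := by
  obtain ⟨U, hU⟩ := exists_universal A
  -- Density is needed only at the universal index `U`, whose argument carries `b`.
  obtain ⟨e, he⟩ := hm U
  exact ⟨e, fun b x c h => he _ c (hU _ b x c h)⟩

/-- The three realizers code the identity, `m` after `m`, and a lifted element of `A` after `m`. -/
theorem isLocalOperator_functionalOperator {m : A} (hm : IsDensityWitness F m) :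
    IsLocalOperator (functionalOperator F m) := by
  obtain ⟨e, he⟩ := hm.exists_uniform
  obtain ⟨l, hl⟩ := exists_lift A
  obtain ⟨r, hr⟩ := exists_comp m
  refine ⟨?_, ?_, ?_⟩
  · obtain ⟨i, -, hi⟩ := hl (ic A)
    refine ⟨(app (const e) (mkPair (const i) (var 0))).closure fun _ => ic A, fun P a ha => ?_⟩
    obtain ⟨d, hd, hda⟩ := he i a a (hi _ a a (mem_app_ic a))
    exact ⟨d, mem_app_closure (mem_app (mem_const e) (mem_mkPair (mem_const i) (mem_var 0)) hd),
      a, ha, hda⟩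
  · obtain ⟨s, -, hs⟩ := hr m
    refine ⟨(app (const e) (mkPair (const s) (var 0))).closure fun _ => ic A, ?_⟩
    rintro P a ⟨b, ⟨c, hc, hbc⟩, hab⟩
    obtain ⟨d, hd, hdc⟩ := he s a c (hs _ a b c hab hbc)
    exact ⟨d, mem_app_closure (mem_app (mem_const e) (mem_mkPair (mem_const s) (mem_var 0)) hd),
      c, hc, hdc⟩
  · let t : Term A := app (const e)
      (mkPair (app (const r) (app (const l) (var 1))) (var 0))
    refine ⟨(lam t).closure fun _ => ic A, fun P Q f hf =>
      ⟨_, mem_app_closure (mem_lam t), ?_⟩⟩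
    rintro a ⟨b, hb, hab⟩
    obtain ⟨c, hbc, hc⟩ := hf b hb
    obtain ⟨f', hf', hlift⟩ := hl f
    obtain ⟨s, hs, hcomp⟩ := hr f'
    obtain ⟨d, hd, hdc⟩ := he s a c (hcomp _ a b c hab (hlift _ b c hbc))
    exact ⟨d, mem_app_closure (mem_app (mem_const e) (mem_mkPair (mem_app (mem_const r)
      (mem_app (mem_const l) (mem_var 1) hf') hs) (mem_var 0)) hd), c, hc, hdc⟩

/-- If `t` tracks `g`, then `m ·^F (t x) = g x`, so precomposing `m` with `t` gives an index of `g`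
that can be put to the oracle. -/
theorem definesMorphism_functionalOperator {m : A} (hm : IsDensityWitness F m) :
    DefinesMorphism (functionalOperator F m) F := by
  obtain ⟨e, he⟩ := hm.exists_uniform
  obtain ⟨p, hp⟩ := exists_precomp m
  obtain ⟨q, hq⟩ := exists_query A p
  refine ⟨(app (const e) (mkPair (const q) (var 0))).closure fun _ => ic A, fun g t ht => ?_⟩
  obtain ⟨w, hw, hwt⟩ := hp t
  have hg : ∀ x, FunctionalApp F w x (g.1 x) := by
    intro x
    obtain ⟨y, hy, c, rfl, hyc⟩ := ht x x rfl
    exact hwt _ x y _ hy hyc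
  obtain ⟨d, hd, hdc⟩ := he q t (F g.1) (hq _ t w _ hw (oracle_of_index F hg))
  exact ⟨d, mem_app_closure (mem_app (mem_const e) (mem_mkPair (mem_const q) (mem_var 0)) hd),
    _, rfl, hdc⟩

end Density

end Realizability

theorem mainTheorem4 {A : Type u} [Realizability.PCA A] (F : (A → A) → A) :
    (∃ m : A, Realizability.IsDensityWitness F m) ∧
    ∀ m : A, Realizability.IsDensityWitness F m →
      Realizability.IsLocalOperator (Realizability.functionalOperator F m) ∧
      Realizability.DefinesMorphism (Realizability.functionalOperator F m) F ∧
      ∀ J : Set A → Set A, Realizability.IsLocalOperator J →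
        Realizability.DefinesMorphism J F →
        Realizability.LocalOperatorLE (Realizability.functionalOperator F m) J := by
  refine ⟨Realizability.exists_isDensityWitness F, fun m hm => ⟨?_, ?_, fun J hJ hF => ?_⟩⟩
  · exact Realizability.isLocalOperator_functionalOperator hm
  · exact Realizability.definesMorphism_functionalOperator hm
  · exact Realizability.functionalOperator_le hJ hF m
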